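/- Let $\mathbb{D}=\{z\in\mathbb{C}:|z|<1\}$. Let $\psi$ be analytic and univalent in $\mathbb{D}$ with $\psi(0)=1$, $\operatorname{Re}\psi>0$ in $\mathbb{D}$, and with nonnegative real Taylor coefficients at $0$, and let $$h_\psi(z)=z\exp\left(\int_0^z\frac{\psi(t)-1}{t}\,dt\right).$$ Let $h$ be analytic in $\mathbb{D}$ with $h(0)=0$, $h'(0)=1$ and $zh'(z)/h(z)\prec\psi(z)$ (that is, $h\in\mathcal{S}^*(\psi)$; $\prec$ denotes subordination in $\mathbb{D}$), and let $g=\varphi h$ in $\mathbb{D}$, where $\varphi$ is analytic in $\mathbb{D}$ and $|\varphi|\le 1$. Suppose that $f=h+\overline{g}\in\mathcal{S}_{\mathcal H}^0$, that is, $f$ is univalent and sense-preserving ($|g'|<|h'|$) in $\mathbb{D}$, with $f(0)=0$, $h'(0)=1$, $g'(0)=0$. A locally univalent harmonic function $f$ is called uniformly starlike in $|z|<R$ if - it is fully starlike there: for every $0<\rho<R$ the circle $|z|=\rho$ is mapped one-to-one onto a curve that does not pass through $0$ and bounds a domain starlike with respect to $0$, and $\frac{\partial}{\partial\theta}\arg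 f(\rho e^{i\theta})>0$ for all $\theta$; and - for every circular arc $\Gamma_\zeta$ contained in $|z|<R$ with center $\zeta$, $|\zeta|<R$, the arc $f(\Gamma_\zeta)$ is starlike with respect to $f(\zeta)$, i.e. $f\ne f(\zeta)$ on $\Gamma_\zeta$ and $\arg\big(f(z)-f(\zeta)\big)$ is nondecreasing as $z$ traverses $\Gamma_\zeta$ in the positive direction. Then: 1. $f$ is uniformly starlike in $|z|<\min\{1/3,r_\psi\}$, where $r_\psi$ is the smallest root in $(0,1)$ of $h_\psi'(r)-\frac54=0$. 2. The function $$F(z)=\Lambda_{0,1}[f](z)=\int_0^z\frac{h(\xi)}{\xi}\,d\xi+\overline{\int_0^z\frac{g(\xi)}{\xi}\,d\xi}$$ is uniformly starlike in $|z|<\min\{1/3,r_\psi\}$, where $r_\psi$ is the smallest root in $(0,1)$ of $4h_\psi(r)-5r=0$. In each part, if the equation has a root in $(0,1)$ then a smallest one exists; if it has none, the assertion holds with $1/3$ in place of $\min\{1/3,r_\psi\}$. -/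

import Mathlib

open Complex ComplexConjugate Set Metric

noncomputable section

/-- The open unit disk. -/
def unitDisk : Set ℂ := ball 0 1

/-- The integral of `F` from `0` to `z` along the segment `t = s z`, `0 ≤ s ≤ 1`. -/
def integralFromZero (F : ℂ → ℂ) (z : ℂ) : ℂ :=
  ∫ s in (0 : ℝ)..1, F ((s : ℂ) * z) * z

/-- The functions `ψ(z) = 1 + p₁ z + p₂ z² + ⋯` admitted in the Ma-Minda classes: univalent in the
disk, with positive real part, and with nonnegative real Taylor coefficients at the origin. -/
structure IsMaMindaFunction (ψ : ℂ → ℂ) : Prop where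
  differentiableOn : DifferentiableOn ℂ ψ unitDisk
  injOn : InjOn ψ unitDisk
  map_zero : ψ 0 = 1
  re_pos : ∀ z ∈ unitDisk, 0 < (ψ z).re
  coeff_nonneg : ∀ n : ℕ, 0 ≤ (iteratedDeriv n ψ 0).re ∧ (iteratedDeriv n ψ 0).im = 0

/-- Subordination `p ≺ q` in the unit disk: `p = q ∘ ω` for a Schwarz function `ω`. -/
def Subordinate (p q : ℂ → ℂ) : Prop :=
  ∃ ω : ℂ → ℂ, DifferentiableOn ℂ ω unitDisk ∧ MapsTo ω unitDisk unitDisk ∧ ω 0 = 0 ∧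
    ∀ z ∈ unitDisk, p z = q (ω z)

/-- `z h'(z) / h(z)`, with its limiting value `1` at the origin (`h(0) = 0`, `h'(0) = 1`). -/
def starlikeQuotient (h : ℂ → ℂ) (z : ℂ) : ℂ :=
  if z = 0 then 1 else z * deriv h z / h z

/-- Membership of `h` in the Ma-Minda class `S*(ψ)`. A zero of `h` at some
`z ≠ 0` is excluded, because the quotient is then `0` in Lean while `ψ` omits the value `0`. -/
structure IsMaMindaStarlike (ψ h : ℂ → ℂ) : Prop where
  differentiableOn : DifferentiableOn ℂ h unitDisk
  map_zero : h 0 = 0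
  deriv_zero : deriv h 0 = 1
  subordinate : Subordinate (starlikeQuotient h) ψ

/-- The function `h_ψ(z) = z exp (∫₀ᶻ (ψ(t) - 1) / t dt)`. -/
def maMindaExtremal (ψ : ℂ → ℂ) (z : ℂ) : ℂ :=
  z * exp (integralFromZero (fun t => (ψ t - 1) / t) z)

/-- The class of analytic functions on the unit disk that are bounded by `1` there. -/
structure IsBoundedByOne (φ : ℂ → ℂ) : Prop where
  differentiableOn : DifferentiableOn ℂ φ unitDisk
  norm_le_one : ∀ z ∈ unitDisk, ‖φ z‖ ≤ 1

/-- The harmonic mapping `f = h + conj g`. -/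
def harmonicMap (h g : ℂ → ℂ) (z : ℂ) : ℂ := h z + conj (g z)

/-- The mapping `f = h + conj g` is of class `S_H⁰`: harmonic, univalent and sense-preserving
(`|f_z|² - |f_z̄|² = |h'|² - |g'|² > 0`) in the unit disk, with `h(0) = g(0) = 0`,
`f_z(0) = h'(0) = 1` and `conj (f_z̄(0)) = g'(0) = 0`. -/
structure IsClassSH0 (h g : ℂ → ℂ) : Prop where
  differentiableOn_left : DifferentiableOn ℂ h unitDisk
  differentiableOn_right : DifferentiableOn ℂ g unitDisk
  injOn : InjOn (harmonicMap h g) unitDisk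
  jacobian_pos : ∀ z ∈ unitDisk, 0 < ‖deriv h z‖ ^ 2 - ‖deriv g z‖ ^ 2
  left_zero : h 0 = 0
  right_zero : g 0 = 0
  deriv_left_zero : deriv h 0 = 1
  deriv_right_zero : deriv g 0 = 0

/-- The operator `Λ_{0,1}`: `F(z) = ∫₀ᶻ h(ξ)/ξ dξ + conj (∫₀ᶻ g(ξ)/ξ dξ)`. -/
def lambdaOperator (h g : ℂ → ℂ) : ℂ → ℂ :=
  harmonicMap (integralFromZero fun ξ => h ξ / ξ) (integralFromZero fun ξ => g ξ / ξ)

/-- The point `ζ + ρ e^{iθ}`. -/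
def circlePoint (ζ : ℂ) (ρ θ : ℝ) : ℂ := ζ + ρ * exp (θ * I)

/-- `A` is a choice of the argument of the nowhere vanishing function `c` on the set `s`. -/
def IsArgumentOn (c : ℝ → ℂ) (A : ℝ → ℝ) (s : Set ℝ) : Prop :=
  ∀ θ ∈ s, c θ ≠ 0 ∧ c θ = ‖c θ‖ * exp (A θ * I)

/-- `f` is fully starlike in `|z| < R`: every circle `|z| = ρ < R` is mapped one-to-one onto a curve
which bounds a domain that is starlike with respect to the origin, and
`∂/∂θ arg f(ρ e^{iθ}) > 0`. -/
def IsFullyStarlike (f : ℂ → ℂ) (R : ℝ) : Prop :=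
  ∀ ρ : ℝ, 0 < ρ → ρ < R →
    InjOn f (sphere 0 ρ) ∧
    (∃ Ω : Set ℂ, IsOpen Ω ∧ Ω.Nonempty ∧ Bornology.IsBounded Ω ∧ StarConvex ℝ 0 Ω ∧
      frontier Ω = f '' sphere 0 ρ) ∧
    ∃ A : ℝ → ℝ, IsArgumentOn (fun θ => f (circlePoint 0 ρ θ)) A univ ∧
      ∀ θ : ℝ, ∃ d : ℝ, HasDerivAt A d θ ∧ 0 < d

/-- The image under `f` of the arc `ζ + ρ e^{iθ}`, `α ≤ θ ≤ β`, is starlike with respect to `w`: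
a continuous branch of the argument of `f - w` is nondecreasing along the arc. -/
def IsStarlikeArc (f : ℂ → ℂ) (ζ : ℂ) (ρ α β : ℝ) (w : ℂ) : Prop :=
  ∃ A : ℝ → ℝ, ContinuousOn A (Icc α β) ∧
    IsArgumentOn (fun θ => f (circlePoint ζ ρ θ) - w) A (Icc α β) ∧ MonotoneOn A (Icc α β)

/-- `f` is uniformly starlike in `|z| < R`: it is harmonic, locally univalent and fully starlike
there, and maps every circular arc that is contained in this disk and has its center `ζ` in this
disk onto an arc which is starlike with respect to `f ζ`. -/
structure IsUniformlyStarlike (f : ℂ → ℂ) (R : ℝ) : Prop where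
  harmonic : InnerProductSpace.HarmonicOnNhd f (ball 0 R)
  locallyUnivalent : ∀ z ∈ ball (0 : ℂ) R, ∃ U ∈ nhds z, InjOn f U
  fullyStarlike : IsFullyStarlike f R
  arcs : ∀ ζ ∈ ball (0 : ℂ) R, ∀ ρ α β : ℝ, 0 < ρ → α < β → β ≤ α + 2 * Real.pi →
    (∀ θ ∈ Icc α β, circlePoint ζ ρ θ ∈ ball (0 : ℂ) R) → IsStarlikeArc f ζ ρ α β (f ζ)

/-- The roots in `(0,1)` of `h_ψ'(r) - 5/4 = 0`. -/
def derivRoots (ψ : ℂ → ℂ) : Set ℝ :=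
  {r | r ∈ Ioo (0 : ℝ) 1 ∧ deriv (maMindaExtremal ψ) (r : ℂ) - 5 / 4 = 0}

/-- The roots in `(0,1)` of `4 h_ψ(r) - 5 r = 0`. -/
def valueRoots (ψ : ℂ → ℂ) : Set ℝ :=
  {r | r ∈ Ioo (0 : ℝ) 1 ∧ 4 * maMindaExtremal ψ (r : ℂ) - 5 * (r : ℂ) = 0}

end

/-! On the disc in question the map is a small perturbation of the identity. If `|h' - 1| ≤ 1/4` and
`|g'| ≤ 5/12`, then `f - id` is Lipschitz with constant `1/4 + 5/12 = 2/3`. Along a circle `z = ζ +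
ρ e^{iθ}`, the chord quotient `q = (f z - f ζ) / (z - ζ)` and the tangent quotient `a = ∂_θ f / ∂_θ
z` then both lie in `|c - 1| ≤ 2/3`. Since `arcsin (2/3) < π/4`, two such numbers differ in argument
by less than `π/2`. The derivative of `arg (f z - f ζ)` is `Re (a / q)`, hence positive
(`hasDerivAt_circleArg`). This yields the arc condition and, for `ζ = 0`, the argument condition on
circles about `0`; the starlike domain is the image of the disc (`smul_mem_image_closedBall`). All
of this is collected in `isUniformlyStarlike_harmonicMap`.

The two bounds come from majorization. Subordination gives `h = z exp ∫ (p - 1)/t` with `p = ψ ∘ ω`.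
Nonnegative coefficients and the Schwarz lemma give `|p z - 1| ≤ ψ(|z|) - 1`, and this passes
through the integral and the exponential to `|h' - 1| ≤ h_ψ'(|z|) - 1` and `|h/z - 1| ≤ h_ψ(|z|)/|z|
- 1`. Below the smallest root the right side is less than `1/4`. The Schwarz lemma for `g'/h'`, or
for `φ` in the second part, bounds the co-analytic derivative by `|z|` times the analytic one, hence
by `1/3 · 5/4 = 5/12`. In the second part the derivatives of the two components are `h/z` and `g/z`.
-/

/-- Two complex numbers within `2/3` of `1` enclose an acute angle, with a uniform bound. -/
theorem norm_div_le_re_div_of_norm_sub_one_le {a b : ℂ} (ha : ‖a - 1‖ ≤ 2 / 3)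
    (hb : ‖b - 1‖ ≤ 2 / 3) : 0 < (a / b).re ∧ ‖a / b‖ ≤ 9 * (a / b).re := by
  have key : ∀ c : ℂ, ‖c - 1‖ ≤ 2 / 3 → 0 < c.re ∧ 5 * c.im ^ 2 ≤ 4 * c.re ^ 2 := by
    intro c hc
    have h1 : ‖c - 1‖ ^ 2 ≤ (2 / 3) ^ 2 := by gcongr
    rw [← normSq_eq_norm_sq, normSq_apply] at h1
    simp only [sub_re, one_re, sub_im, one_im, sub_zero] at h1
    have h2 : 0 < c.re := by nlinarith [sq_nonneg c.im, sq_nonneg c.re]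
    -- The square vanishes at `Re c = 5/9`, where the tangents from `0` touch the disc; their slope
    -- squared is `4/5`.
    exact ⟨h2, by nlinarith [sq_nonneg (c.re * 9 - 5)]⟩
  obtain ⟨ha1, ha2⟩ := key a ha
  obtain ⟨hb1, hb2⟩ := key b hb
  have hb0 : b ≠ 0 := fun h => by simp [h] at hb1
  have hn : 0 < normSq b := normSq_pos.2 hb0
  have hab : 0 < a.re * b.re := mul_pos ha1 hb1
  have him : |a.im * b.im| ≤ 4 / 5 * (a.re * b.re) := by
    refine abs_le_of_sq_le_sq ?_ (by positivity)
    have h3 : (5 * a.im ^ 2) * (5 * b.im ^ 2) ≤ (4 * a.re ^ 2) * (4 * b.re ^ 2) := by gcongr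
    nlinarith
  have hnorm : ‖a‖ * ‖b‖ ≤ 9 / 5 * (a.re * b.re) := by
    refine (abs_le_of_sq_le_sq' ?_ (by positivity)).2
    have h3 : (5 * normSq a) * (5 * normSq b) ≤ (9 * a.re ^ 2) * (9 * b.re ^ 2) := by
      rw [normSq_apply, normSq_apply]
      refine mul_le_mul (by nlinarith) (by nlinarith) ?_ (by positivity)
      nlinarith [mul_self_nonneg b.re, mul_self_nonneg b.im]
    rw [normSq_eq_norm_sq, normSq_eq_norm_sq] at h3
    nlinarith
  have h4 := neg_abs_le (a.im * b.im)
  have hnb : 0 < ‖b‖ := norm_pos_iff.2 hb0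
  rw [div_re, ← add_div, norm_div]
  refine ⟨div_pos (by linarith) hn, ?_⟩
  rw [← mul_div_assoc, div_le_div_iff₀ hnb hn, normSq_eq_norm_sq]
  nlinarith

theorem re_div_pos_of_norm_sub_one_le {a b : ℂ} (ha : ‖a - 1‖ ≤ 2 / 3) (hb : ‖b - 1‖ ≤ 2 / 3) :
    0 < (a / b).re :=
  (norm_div_le_re_div_of_norm_sub_one_le ha hb).1

/-! ### Maps that differ from the identity by a 2/3-Lipschitz function. -/

section ApproxId

variable {f : ℂ → ℂ} {R : ℝ}

theorem norm_sub_div_sub_one_le {x y : ℂ} (hxy : x ≠ y)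
    (hf : ‖f x - f y - (x - y)‖ ≤ 2 / 3 * ‖x - y‖) : ‖(f x - f y) / (x - y) - 1‖ ≤ 2 / 3 := by
  have h : x - y ≠ 0 := sub_ne_zero.2 hxy
  rw [div_sub_one h, norm_div]
  exact (div_le_iff₀ (norm_pos_iff.2 h)).2 hf

theorem injOn_of_norm_sub_sub_le
    (hf : ∀ x ∈ ball (0 : ℂ) R, ∀ y ∈ ball (0 : ℂ) R, ‖f x - f y - (x - y)‖ ≤ 2 / 3 * ‖x - y‖) :
    InjOn f (ball 0 R) := by
  intro x hx y hy hxy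
  have h := hf x hx y hy
  rw [hxy, sub_self, zero_sub, norm_neg] at h
  exact sub_eq_zero.1 (norm_eq_zero.1 (by linarith [norm_nonneg (x - y)]))

theorem approximatesLinearOn_of_norm_sub_sub_le
    (hf : ∀ x ∈ ball (0 : ℂ) R, ∀ y ∈ ball (0 : ℂ) R, ‖f x - f y - (x - y)‖ ≤ 2 / 3 * ‖x - y‖) :
    ApproximatesLinearOn f (ContinuousLinearEquiv.refl ℝ ℂ : ℂ →L[ℝ] ℂ) (ball 0 R) (2 / 3) := by
  intro x hx y hy
  simpa using hf x hx y hy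

theorem isOpen_image_ball_of_norm_sub_sub_le
    (hf : ∀ x ∈ ball (0 : ℂ) R, ∀ y ∈ ball (0 : ℂ) R, ‖f x - f y - (x - y)‖ ≤ 2 / 3 * ‖x - y‖) :
    IsOpen (f '' ball 0 R) := by
  refine ((approximatesLinearOn_of_norm_sub_sub_le hf).toOpenPartialHomeomorph f _
    (Or.inr ?_) isOpen_ball).open_target
  have h1 : ‖((ContinuousLinearEquiv.refl ℝ ℂ).symm : ℂ →L[ℝ] ℂ)‖₊ = 1 := by
    simp
  rw [h1, inv_one, ← NNReal.coe_lt_coe]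
  norm_num

/-- A radial step from `f z` towards the origin is the image of a point of smaller modulus. -/
theorem norm_lt_of_radial_step {z y : ℂ} {t : ℝ} (hz : z ≠ 0) (ht : 0 < t)
    (hz0 : ‖f z - z‖ ≤ 2 / 3 * ‖z‖) (hyz : ‖f y - f z - (y - z)‖ ≤ 2 / 3 * ‖y - z‖)
    (hy : f y = (1 - t : ℝ) * f z) (hsmall : 45 * t < 1) : ‖y‖ < ‖z‖ := by
  -- `v` is the displacement from `z` to `y` in units of `-t z`, so the chord quotient of `f`
  -- between `y` and `z` is `b / v` with `b = f z / z`. Both `b` and `b / v` are within `2/3` of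
  -- `1`, which keeps `v` in a sector about the positive axis.
  set v : ℂ := (y - z) / (-(t : ℂ) * z) with hv
  have htC : (t : ℂ) ≠ 0 := by exact_mod_cast ht.ne'
  have hzp : 0 < ‖z‖ := norm_pos_iff.2 hz
  have hyv : y = z * (1 - t * v) := by rw [hv]; field_simp; ring
  set b : ℂ := f z / z with hb
  have hfb : f z = z * b := by rw [hb]; field_simp
  have hb1 : ‖b - 1‖ ≤ 2 / 3 := by
    rw [hb, div_sub_one hz, norm_div]; exact (div_le_iff₀ hzp).2 hz0
  have hvb : ‖v - b‖ ≤ 2 / 3 * ‖v‖ := by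
    have e1 : f y - f z - (y - z) = z * t * (v - b) := by
      rw [hy, hfb, hyv]; push_cast; ring
    have e2 : y - z = -(z * t * v) := by rw [hyv]; ring
    rw [e1, e2, norm_neg, norm_mul, norm_mul (z * t)] at hyz
    have hpos : 0 < ‖z * (t : ℂ)‖ := norm_pos_iff.2 (mul_ne_zero hz htC)
    nlinarith
  have hbn : ‖b‖ ≤ 5 / 3 := by
    have := norm_add_le (b - 1) 1
    rw [sub_add_cancel, norm_one] at this; linarith
  have hvn : ‖v‖ ≤ 5 := by
    have := norm_add_le (v - b) b
    rw [sub_add_cancel] at this; linarith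
  have hb0 : b ≠ 0 := fun h => by rw [h] at hb1; norm_num at hb1
  have hv0 : 0 < ‖v‖ := by
    refine norm_pos_iff.2 fun h => hb0 ?_
    simpa [h] using hvb
  have hbv : ‖b / v - 1‖ ≤ 2 / 3 := by
    rw [div_sub_one (norm_pos_iff.1 hv0), norm_div, norm_sub_rev]
    exact (div_le_iff₀ hv0).2 hvb
  have hre : ‖v‖ ≤ 9 * v.re := by
    have := (norm_div_le_re_div_of_norm_sub_one_le hb1 hbv).2
    rwa [div_div_cancel₀ hb0] at this
  have h1 : ‖1 - t * v‖ ^ 2 < 1 := by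
    have e : ‖1 - t * v‖ ^ 2 = 1 - 2 * t * v.re + t ^ 2 * ‖v‖ ^ 2 := by
      rw [← normSq_eq_norm_sq, ← normSq_eq_norm_sq, normSq_apply, normSq_apply]
      simp; ring
    rw [e]
    -- Since `‖v‖ ≤ 5`, the condition `45 t < 1` gives `t ‖v‖ < 1/9`, so the quadratic term is
    -- absorbed by `2 t Re v ≥ 2 t ‖v‖ / 9`.
    have h5 : t * ‖v‖ * (t * ‖v‖) ≤ t * ‖v‖ * (1 / 9) := by gcongr; nlinarith
    have h6 : 0 < t * ‖v‖ := mul_pos ht hv0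
    have h7 : t * ‖v‖ ≤ t * (9 * v.re) := by gcongr
    nlinarith
  have h2 : ‖1 - t * v‖ < 1 := by
    by_contra! h; nlinarith
  rw [hyv, norm_mul]
  nlinarith

/-- Continuous induction along the segment from `f z` to `0`: the parameters whose point has a
preimage of modulus at most `‖z‖` form a closed set, and openness of the image together with
`norm_lt_of_radial_step` lets one always advance a little. -/
theorem smul_mem_image_closedBall
    (hf : ∀ x ∈ ball (0 : ℂ) R, ∀ y ∈ ball (0 : ℂ) R, ‖f x - f y - (x - y)‖ ≤ 2 / 3 * ‖x - y‖)
    (h0 : f 0 = 0) {z : ℂ} (hz : z ∈ ball (0 : ℂ) R) {s : ℝ} (hs : s ∈ Icc (0 : ℝ) 1) :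
    (s : ℂ) * f z ∈ f '' closedBall 0 ‖z‖ := by
  have hzR : ‖z‖ < R := mem_ball_zero_iff.1 hz
  have hR : 0 < R := (norm_nonneg z).trans_lt hzR
  have h0R : (0 : ℂ) ∈ ball (0 : ℂ) R := mem_ball_self hR
  have hsub : closedBall (0 : ℂ) ‖z‖ ⊆ ball 0 R := closedBall_subset_ball hzR
  have hcont : ContinuousOn f (ball 0 R) :=
    (approximatesLinearOn_of_norm_sub_sub_le hf).continuousOn
  have hcl : IsClosed (f '' closedBall 0 ‖z‖) :=
    ((isCompact_closedBall _ _).image_of_continuousOn (hcont.mono hsub)).isClosed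
  have hT : Icc (0 : ℝ) 1 ⊆ {t : ℝ | ((1 - t : ℝ) : ℂ) * f z ∈ f '' closedBall 0 ‖z‖} := by
    refine IsClosed.Icc_subset_of_forall_exists_gt ?_ ?_ ?_
    · exact (hcl.preimage (by fun_prop)).inter isClosed_Icc
    · exact ⟨z, by simp, by simp⟩
    · rintro x ⟨⟨z₀, hz₀, hfz₀⟩, hx⟩ y hy
      have hx1 : 0 < 1 - x := by linarith [hx.2]
      have hz₀R : z₀ ∈ ball (0 : ℂ) R := hsub hz₀
      have hstep : ∀ᶠ t : ℝ in nhds 0, ((1 - t : ℝ) : ℂ) * f z₀ ∈ f '' ball 0 R := by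
        have hc : Continuous fun t : ℝ => ((1 - t : ℝ) : ℂ) * f z₀ := by fun_prop
        exact hc.continuousAt.eventually_mem
          ((isOpen_image_ball_of_norm_sub_sub_le hf).mem_nhds ⟨z₀, hz₀R, by simp⟩)
      obtain ⟨ε, hε, hball⟩ := Metric.eventually_nhds_iff_ball.1 hstep
      have hyx : 0 < (y - x) / (1 - x) := div_pos (sub_pos.2 hy) hx1
      obtain ⟨t, ht0, ht⟩ := exists_between
        (lt_min (lt_min hε (by norm_num : (0 : ℝ) < 1 / 45)) hyx)
      have htε : t < ε := ht.trans_le ((min_le_left _ _).trans (min_le_left _ _))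
      have ht45 : t < 1 / 45 := ht.trans_le ((min_le_left _ _).trans (min_le_right _ _))
      have hty : t < (y - x) / (1 - x) := ht.trans_le (min_le_right _ _)
      rw [lt_div_iff₀ hx1] at hty
      -- A relative step `t` from the current point `(1 - x) f z` lands at `(1 - t)(1 - x) f z`.
      refine ⟨x + t * (1 - x), ?_, by nlinarith [mul_pos ht0 hx1], by linarith⟩
      have heq : ((1 - (x + t * (1 - x)) : ℝ) : ℂ) * f z = ((1 - t : ℝ) : ℂ) * f z₀ := by
        rw [hfz₀]; push_cast; ring
      rw [mem_ofPred_eq, heq]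
      obtain ⟨y', hy', hfy'⟩ := hball t (by simpa [abs_of_pos ht0] using htε)
      rcases eq_or_ne z₀ 0 with rfl | hne
      · exact ⟨0, by simp, by simp [h0]⟩
      · refine ⟨y', ?_, hfy'⟩
        have := norm_lt_of_radial_step hne ht0 (by simpa [h0] using hf z₀ hz₀R 0 h0R)
          (hf y' hy' z₀ hz₀R) hfy' (by linarith)
        rw [mem_closedBall_zero_iff] at hz₀ ⊢
        linarith
  have := hT (show 1 - s ∈ Icc (0 : ℝ) 1 from ⟨by linarith [hs.2], by linarith [hs.1]⟩)
  simpa using this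

/-- The domain is the image of the open disc. Its closure is the image of the closed disc, and
injectivity leaves exactly the image of the circle as frontier. -/
theorem exists_starConvex_frontier_eq
    (hf : ∀ x ∈ ball (0 : ℂ) R, ∀ y ∈ ball (0 : ℂ) R, ‖f x - f y - (x - y)‖ ≤ 2 / 3 * ‖x - y‖)
    (h0 : f 0 = 0) {ρ : ℝ} (hρ : 0 < ρ) (hρR : ρ < R) :
    ∃ Ω : Set ℂ, IsOpen Ω ∧ Ω.Nonempty ∧ Bornology.IsBounded Ω ∧ StarConvex ℝ 0 Ω ∧
      frontier Ω = f '' sphere 0 ρ := by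
  have hsub : closedBall (0 : ℂ) ρ ⊆ ball 0 R := closedBall_subset_ball hρR
  have hsub' : ball (0 : ℂ) ρ ⊆ ball 0 R := ball_subset_closedBall.trans hsub
  have hcont : ContinuousOn f (closedBall 0 ρ) :=
    (approximatesLinearOn_of_norm_sub_sub_le hf).continuousOn.mono hsub
  have hcomp : IsCompact (f '' closedBall 0 ρ) :=
    (isCompact_closedBall _ _).image_of_continuousOn hcont
  have hopen : IsOpen (f '' ball 0 ρ) :=
    isOpen_image_ball_of_norm_sub_sub_le fun x hx y hy => hf x (hsub' hx) y (hsub' hy)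
  refine ⟨f '' ball 0 ρ, hopen, ⟨f 0, 0, mem_ball_self hρ, rfl⟩,
    hcomp.isBounded.subset (image_mono ball_subset_closedBall), ?_, ?_⟩
  · rw [starConvex_zero_iff]
    rintro _ ⟨z, hz, rfl⟩ a ha ha1
    obtain ⟨y, hy, hfy⟩ := smul_mem_image_closedBall hf h0 (hsub' hz) ⟨ha, ha1⟩
    refine ⟨y, ?_, by rw [hfy, real_smul]⟩
    rw [mem_closedBall_zero_iff] at hy
    rw [mem_ball_zero_iff] at hz ⊢
    exact hy.trans_lt hz
  · have hcl : closure (f '' ball 0 ρ) = f '' closedBall 0 ρ := by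
      refine (closure_minimal (image_mono ball_subset_closedBall) hcomp.isClosed).antisymm ?_
      rw [← closure_ball (0 : ℂ) hρ.ne'] at hcont ⊢
      exact hcont.image_closure
    rw [frontier, hcl, hopen.interior_eq, ← closedBall_sdiff_ball]
    exact (((injOn_of_norm_sub_sub_le hf).mono hsub).image_sdiff_subset
      ball_subset_closedBall).symm

end ApproxId

/-! ### The argument along a circle. -/

theorem circlePoint_sub (ζ : ℂ) (ρ θ : ℝ) : circlePoint ζ ρ θ - ζ = ρ * exp (θ * I) := by
  simp [circlePoint]

theorem hasDerivAt_circlePoint (ζ : ℂ) (ρ θ : ℝ) :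
    HasDerivAt (circlePoint ζ ρ) (ρ * exp (θ * I) * I) θ := by
  have h1 : HasDerivAt (fun t : ℝ => (t : ℂ) * I) I θ := by
    simpa using (ofRealCLM.hasDerivAt (x := θ)).mul_const I
  convert! (h1.cexp.const_mul (ρ : ℂ)).const_add ζ using 1
  ring

/-- The continuous choice of the argument of `f - w` along the circle of radius `ρ` about `ζ`,
for `f` close to the identity. -/
noncomputable def circleArg (f : ℂ → ℂ) (ζ : ℂ) (ρ : ℝ) (w : ℂ) (θ : ℝ) : ℝ :=
  θ + arg ((f (circlePoint ζ ρ θ) - w) * ((ρ : ℂ)⁻¹ * exp (-(θ * I))))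

section Argument

variable {f : ℂ → ℂ} {ζ w : ℂ} {ρ θ : ℝ}

theorem argument_circleArg (hρ : 0 < ρ)
    (hq : ‖(f (circlePoint ζ ρ θ) - w) * ((ρ : ℂ)⁻¹ * exp (-(θ * I))) - 1‖ ≤ 2 / 3) :
    f (circlePoint ζ ρ θ) - w ≠ 0 ∧ f (circlePoint ζ ρ θ) - w =
      ‖f (circlePoint ζ ρ θ) - w‖ * exp (circleArg f ζ ρ w θ * I) := by
  set c := f (circlePoint ζ ρ θ) - w with hc
  refine ⟨fun h => by rw [h] at hq; norm_num at hq, ?_⟩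
  have hρC : (ρ : ℂ) ≠ 0 := by exact_mod_cast hρ.ne'
  have h1 := norm_mul_exp_arg_mul_I (c * ((ρ : ℂ)⁻¹ * exp (-(θ * I))))
  have h2 : ‖exp (-(θ * I))‖ = 1 := by
    have := norm_exp_ofReal_mul_I (-θ)
    simpa using this
  rw [norm_mul, norm_mul, h2, norm_inv, norm_real, Real.norm_of_nonneg hρ.le] at h1
  rw [circleArg, ofReal_add, add_mul, exp_add, ← hc]
  calc c = ρ * exp (θ * I) * (c * ((ρ : ℂ)⁻¹ * exp (-(θ * I)))) := by
        rw [exp_neg]; field_simp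
    _ = _ := by
        conv_lhs => rw [← h1]
        push_cast; field_simp

/-- The quotient `q` stays in the right half-plane, so its principal argument is smooth. From `q' =
i (a - q)` the derivative is `1 + Im (i (a - q) / q) = Re (a / q)`. -/
theorem hasDerivAt_circleArg {a : ℂ}
    (hq : ‖(f (circlePoint ζ ρ θ) - w) * ((ρ : ℂ)⁻¹ * exp (-(θ * I))) - 1‖ ≤ 2 / 3)
    (ha : ‖a - 1‖ ≤ 2 / 3) (hρ : ρ ≠ 0)
    (hd : HasDerivAt (fun t => f (circlePoint ζ ρ t)) (ρ * exp (θ * I) * I * a) θ) :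
    ∃ d : ℝ, HasDerivAt (circleArg f ζ ρ w) d θ ∧ 0 < d := by
  have hρC : (ρ : ℂ) ≠ 0 := by exact_mod_cast hρ
  set q := (f (circlePoint ζ ρ θ) - w) * ((ρ : ℂ)⁻¹ * exp (-(θ * I))) with hqdef
  have hqre : 0 < q.re := by
    simpa using re_div_pos_of_norm_sub_one_le hq (b := 1) (by norm_num)
  have hq0 : q ≠ 0 := fun h => by simp [h] at hqre
  have h1 : HasDerivAt (fun t : ℝ => -((t : ℂ) * I)) (-I) θ := by
    convert! ((ofRealCLM.hasDerivAt (x := θ)).mul_const I).neg using 1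
    simp
  have h2 : HasDerivAt (fun t : ℝ => (f (circlePoint ζ ρ t) - w) *
      ((ρ : ℂ)⁻¹ * exp (-(t * I)))) (I * a - I * q) θ := by
    convert! (hd.sub_const w).mul (h1.cexp.const_mul (ρ : ℂ)⁻¹) using 1
    rw [hqdef, exp_neg]
    field_simp
    ring
  have h3 := (imCLM.hasFDerivAt.comp_hasDerivAt θ (h2.clog_real (Or.inl hqre)))
  refine ⟨1 + ((I * a - I * q) / q).im, (hasDerivAt_id θ).add ?_, ?_⟩
  · simpa [Function.comp_def, log_im] using h3
  · rw [← mul_sub, mul_div_assoc, I_mul_im, sub_div, div_self hq0, sub_re, one_re]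
    linarith [re_div_pos_of_norm_sub_one_le ha hq]

end Argument

/-! ### Uniform starlikeness from derivative bounds. -/

section HarmonicMap

variable {h g : ℂ → ℂ} {R : ℝ}

theorem norm_harmonicMap_sub_sub_le (hh : DifferentiableOn ℂ h (ball 0 R))
    (hg : DifferentiableOn ℂ g (ball 0 R)) (bh : ∀ z ∈ ball (0 : ℂ) R, ‖deriv h z - 1‖ ≤ 1 / 4)
    (bg : ∀ z ∈ ball (0 : ℂ) R, ‖deriv g z‖ ≤ 5 / 12) :
    ∀ x ∈ ball (0 : ℂ) R, ∀ y ∈ ball (0 : ℂ) R,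
      ‖harmonicMap h g x - harmonicMap h g y - (x - y)‖ ≤ 2 / 3 * ‖x - y‖ := by
  intro x hx y hy
  have hd : ∀ z ∈ ball (0 : ℂ) R, HasDerivAt h (deriv h z) z := fun z hz =>
    (hh.differentiableAt (isOpen_ball.mem_nhds hz)).hasDerivAt
  have gd : ∀ z ∈ ball (0 : ℂ) R, HasDerivAt g (deriv g z) z := fun z hz =>
    (hg.differentiableAt (isOpen_ball.mem_nhds hz)).hasDerivAt
  have h1 := (convex_ball (0 : ℂ) R).norm_image_sub_le_of_norm_hasDerivWithin_le
    (fun z hz => ((hd z hz).sub (hasDerivAt_id z)).hasDerivWithinAt) bh hy hx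
  have h2 := (convex_ball (0 : ℂ) R).norm_image_sub_le_of_norm_hasDerivWithin_le
    (fun z hz => (gd z hz).hasDerivWithinAt) bg hy hx
  have e : harmonicMap h g x - harmonicMap h g y - (x - y) =
      ((h - id : ℂ → ℂ) x - (h - id : ℂ → ℂ) y) + conj (g x - g y) := by
    simp [harmonicMap]; ring
  rw [e]
  refine (norm_add_le _ _).trans ?_
  rw [norm_conj]
  linarith

theorem hasDerivAt_harmonicMap_circlePoint {ζ : ℂ} {ρ θ : ℝ} (hρ : ρ ≠ 0)
    (hh : DifferentiableAt ℂ h (circlePoint ζ ρ θ))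
    (hg : DifferentiableAt ℂ g (circlePoint ζ ρ θ))
    (bh : ‖deriv h (circlePoint ζ ρ θ) - 1‖ ≤ 1 / 4)
    (bg : ‖deriv g (circlePoint ζ ρ θ)‖ ≤ 5 / 12) :
    ∃ a : ℂ, ‖a - 1‖ ≤ 2 / 3 ∧ HasDerivAt (fun t => harmonicMap h g (circlePoint ζ ρ t))
      (ρ * exp (θ * I) * I * a) θ := by
  set z := circlePoint ζ ρ θ
  set e : ℂ := ρ * exp (θ * I) * I with he
  have he0 : e ≠ 0 := by simp [he, hρ]
  -- With tangent vector `e`, the derivative along the circle is `e h' + conj (e g')`; dividing by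
  -- `e` leaves the modulus of the second term equal to `|g'|`.
  refine ⟨deriv h z + conj (e * deriv g z) / e, ?_, ?_⟩
  · have h1 : ‖conj (e * deriv g z) / e‖ = ‖deriv g z‖ := by
      rw [norm_div, norm_conj, norm_mul, mul_div_cancel_left₀ _ (norm_ne_zero_iff.2 he0)]
    rw [add_sub_right_comm]
    refine (norm_add_le _ _).trans ?_
    linarith
  · have hc := hasDerivAt_circlePoint ζ ρ θ
    have h1 := hh.hasDerivAt.comp_of_eq θ hc rfl
    have h2 := hg.hasDerivAt.comp_of_eq θ hc rfl
    have h3 := conjCLE.toContinuousLinearMap.hasFDerivAt.comp_hasDerivAt θ h2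
    convert! h1.add h3 using 1
    simp only [← he]
    rw [mul_add, mul_div_cancel₀ _ he0]
    simp [mul_comm]

theorem isUniformlyStarlike_harmonicMap (hh : DifferentiableOn ℂ h (ball 0 R))
    (hg : DifferentiableOn ℂ g (ball 0 R)) (h0 : h 0 = 0) (g0 : g 0 = 0)
    (bh : ∀ z ∈ ball (0 : ℂ) R, ‖deriv h z - 1‖ ≤ 1 / 4)
    (bg : ∀ z ∈ ball (0 : ℂ) R, ‖deriv g z‖ ≤ 5 / 12) :
    IsUniformlyStarlike (harmonicMap h g) R := by
  have hf := norm_harmonicMap_sub_sub_le hh hg bh bg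
  have hinj := injOn_of_norm_sub_sub_le hf
  have hf0 : harmonicMap h g 0 = 0 := by simp [harmonicMap, h0, g0]
  have hq : ∀ ζ ∈ ball (0 : ℂ) R, ∀ ρ θ : ℝ, 0 < ρ → circlePoint ζ ρ θ ∈ ball (0 : ℂ) R →
      ‖(harmonicMap h g (circlePoint ζ ρ θ) - harmonicMap h g ζ) *
        ((ρ : ℂ)⁻¹ * exp (-(θ * I))) - 1‖ ≤ 2 / 3 := by
    intro ζ hζ ρ θ hρ hz
    have hne : circlePoint ζ ρ θ ≠ ζ := by
      rw [← sub_ne_zero, circlePoint_sub]; simp [hρ.ne']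
    have := norm_sub_div_sub_one_le hne (hf _ hz ζ hζ)
    rwa [circlePoint_sub, div_eq_mul_inv, mul_inv, ← exp_neg] at this
  have hA : ∀ ζ ∈ ball (0 : ℂ) R, ∀ ρ θ : ℝ, 0 < ρ → circlePoint ζ ρ θ ∈ ball (0 : ℂ) R →
      ∃ d : ℝ, HasDerivAt (circleArg (harmonicMap h g) ζ ρ (harmonicMap h g ζ)) d θ ∧ 0 < d := by
    intro ζ hζ ρ θ hρ hz
    obtain ⟨a, ha, hd⟩ := hasDerivAt_harmonicMap_circlePoint hρ.ne'
      (hh.differentiableAt (isOpen_ball.mem_nhds hz))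
      (hg.differentiableAt (isOpen_ball.mem_nhds hz)) (bh _ hz) (bg _ hz)
    exact hasDerivAt_circleArg (hq ζ hζ ρ θ hρ hz) ha hρ.ne' hd
  refine ⟨?_, ?_, ?_, ?_⟩
  · intro z hz
    exact ((hh.analyticAt (isOpen_ball.mem_nhds hz)).harmonicAt).add
      ((hg.analyticAt (isOpen_ball.mem_nhds hz)).harmonicAt_conj)
  · exact fun z hz => ⟨ball 0 R, isOpen_ball.mem_nhds hz, hinj⟩
  · intro ρ hρ hρR
    have h0R : (0 : ℂ) ∈ ball (0 : ℂ) R := mem_ball_self (hρ.trans hρR)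
    have hmem : ∀ θ : ℝ, circlePoint 0 ρ θ ∈ ball (0 : ℂ) R := by
      intro θ
      simpa [circlePoint, norm_exp_ofReal_mul_I, abs_of_pos hρ] using hρR
    refine ⟨hinj.mono (sphere_subset_closedBall.trans (closedBall_subset_ball hρR)),
      exists_starConvex_frontier_eq hf hf0 hρ hρR,
      circleArg (harmonicMap h g) 0 ρ (harmonicMap h g 0), ?_, ?_⟩
    · intro θ _
      simpa [hf0] using argument_circleArg hρ (hq 0 h0R ρ θ hρ (hmem θ))
    · exact fun θ => hA 0 h0R ρ θ hρ (hmem θ)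
  · intro ζ hζ ρ α β hρ _ _ hmem
    have hcont : ContinuousOn (circleArg (harmonicMap h g) ζ ρ (harmonicMap h g ζ)) (Icc α β) := by
      intro θ hθ
      obtain ⟨d, hd, -⟩ := hA ζ hζ ρ θ hρ (hmem θ hθ)
      exact hd.continuousAt.continuousWithinAt
    refine ⟨_, hcont, fun θ hθ => argument_circleArg hρ (hq ζ hζ ρ θ hρ (hmem θ hθ)), ?_⟩
    refine monotoneOn_of_deriv_nonneg (convex_Icc α β) hcont ?_ ?_
    · intro θ hθ
      obtain ⟨d, hd, -⟩ := hA ζ hζ ρ θ hρ (hmem θ (interior_subset hθ))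
      exact hd.differentiableAt.differentiableWithinAt
    · intro θ hθ
      obtain ⟨d, hd, hpos⟩ := hA ζ hζ ρ θ hρ (hmem θ (interior_subset hθ))
      rw [hd.deriv]; exact hpos.le

end HarmonicMap

/-! ### Integrals of `p(t)/t` from the origin. -/

section IntegralFromZero

variable {p P : ℂ → ℂ} {z : ℂ}

theorem unitDisk_mem_nhds (hz : z ∈ unitDisk) : unitDisk ∈ nhds z :=
  isOpen_ball.mem_nhds hz

theorem zero_mem_unitDisk : (0 : ℂ) ∈ unitDisk := mem_ball_self one_pos

theorem mem_unitDisk_iff : z ∈ unitDisk ↔ ‖z‖ < 1 := mem_ball_zero_iff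

theorem mul_dslope_zero (hp0 : p 0 = 0) (z : ℂ) : z * dslope p 0 z = p z := by
  simpa [hp0] using sub_smul_dslope p 0 z

theorem ofReal_mul_mem_unitDisk (hz : z ∈ unitDisk) {s : ℝ} (hs : s ∈ Icc (0 : ℝ) 1) :
    (s : ℂ) * z ∈ unitDisk := by
  rw [mem_unitDisk_iff] at hz ⊢
  rw [norm_mul, norm_real, Real.norm_of_nonneg hs.1]
  nlinarith [hs.1, hs.2, norm_nonneg z]

theorem div_mul_eq_dslope (hp0 : p 0 = 0) {s : ℝ} (hs : s ≠ 0) :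
    p (s * z) / (s * z) * z = dslope p 0 (s * z) * z := by
  rcases eq_or_ne z 0 with rfl | hz
  · simp
  · have hsz : (s : ℂ) * z ≠ 0 := mul_ne_zero (by exact_mod_cast hs) hz
    rw [← mul_dslope_zero hp0 (s * z), mul_div_cancel_left₀ _ hsz]

/-- The integrands can differ only at `s = 0`, where the division yields `0`. Passing to `dslope`
removes the singularity and makes the integrand analytic. -/
theorem integralFromZero_div_eq (hp0 : p 0 = 0) (z : ℂ) :
    integralFromZero (fun t => p t / t) z = ∫ s in (0 : ℝ)..1, dslope p 0 (s * z) * z :=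
  intervalIntegral.integral_congr_Ioo_of_le zero_le_one fun _ hs =>
    div_mul_eq_dslope hp0 hs.1.ne'

theorem differentiableOn_dslope_zero (hp : DifferentiableOn ℂ p unitDisk) :
    DifferentiableOn ℂ (dslope p 0) unitDisk :=
  (differentiableOn_dslope (unitDisk_mem_nhds zero_mem_unitDisk)).2 hp

theorem continuousOn_dslope_mul (hp : DifferentiableOn ℂ p unitDisk) (hz : z ∈ unitDisk) :
    ContinuousOn (fun s : ℝ => dslope p 0 (s * z) * z) (uIcc 0 1) := by
  rw [uIcc_of_le zero_le_one]
  refine ContinuousOn.mul ?_ continuousOn_const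
  exact (differentiableOn_dslope_zero hp).continuousOn.comp (by fun_prop)
    fun s hs => ofReal_mul_mem_unitDisk hz hs

theorem integralFromZero_zero (F : ℂ → ℂ) : integralFromZero F 0 = 0 := by
  simp [integralFromZero]

theorem hasDerivAt_integralFromZero_div (hp : DifferentiableOn ℂ p unitDisk) (hp0 : p 0 = 0)
    (hz : z ∈ unitDisk) :
    HasDerivAt (integralFromZero fun t => p t / t) (dslope p 0 z) z := by
  obtain ⟨G, hG0, hG⟩ := (DifferentiableOn.isExactOn_ball
    (differentiableOn_dslope_zero hp)).with_val_at 0 0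
  refine (hG z hz).congr_of_eventuallyEq ?_
  filter_upwards [unitDisk_mem_nhds hz] with w hw
  rw [integralFromZero_div_eq hp0, intervalIntegral.integral_eq_sub_of_hasDerivAt
    (f := fun s : ℝ => G (s * w)) ?_ (continuousOn_dslope_mul hp hw).intervalIntegrable]
  · simp [hG0]
  · intro s hs
    rw [uIcc_of_le zero_le_one] at hs
    have h1 : HasDerivAt (fun t : ℝ => (t : ℂ) * w) w s := by
      simpa using (ofRealCLM.hasDerivAt (x := s)).mul_const w
    exact (hG _ (ofReal_mul_mem_unitDisk hw hs)).comp_of_eq s h1 rfl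

theorem differentiableOn_integralFromZero_div (hp : DifferentiableOn ℂ p unitDisk)
    (hp0 : p 0 = 0) : DifferentiableOn ℂ (integralFromZero fun t => p t / t) unitDisk :=
  fun _ hz => (hasDerivAt_integralFromZero_div hp hp0 hz).differentiableAt.differentiableWithinAt

theorem ofReal_norm_mem_unitDisk (hz : z ∈ unitDisk) : ((‖z‖ : ℝ) : ℂ) ∈ unitDisk := by
  rw [mem_unitDisk_iff] at hz ⊢
  rwa [norm_real, norm_norm]

theorem integralFromZero_div_ofReal_im {r : ℝ} (hP : DifferentiableOn ℂ P unitDisk)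
    (hP0 : P 0 = 0) (hr : r ∈ Ico (0 : ℝ) 1) (him : ∀ t ∈ Ico (0 : ℝ) 1, (P t).im = 0) :
    (integralFromZero (fun t => P t / t) r).im = 0 := by
  have hrd : (r : ℂ) ∈ unitDisk := by
    rw [mem_unitDisk_iff, norm_real, Real.norm_of_nonneg hr.1]; exact hr.2
  rw [integralFromZero_div_eq hP0, ← imCLM_apply,
    ← imCLM.intervalIntegral_comp_comm (continuousOn_dslope_mul hP hrd).intervalIntegrable]
  rw [intervalIntegral.integral_congr_Ioo_of_le (g := fun _ => (0 : ℝ)) zero_le_one]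
  · simp
  · intro s hs
    have hsr : s * r ∈ Ico (0 : ℝ) 1 :=
      ⟨mul_nonneg hs.1.le hr.1, by nlinarith [hs.1, hs.2, hr.1, hr.2]⟩
    have h1 := him _ hsr
    rw [ofReal_mul] at h1
    simp only [imCLM_apply]
    rw [← div_mul_eq_dslope hP0 hs.1.ne', im_mul_ofReal, ← ofReal_mul, div_ofReal_im, ofReal_mul,
      h1, zero_div, zero_mul]

/-- A majorization `‖p w‖ ≤ P ‖w‖` passes to the integrals of `p t / t` and `P t / t`. -/
theorem norm_integralFromZero_div_le (hp0 : p 0 = 0)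
    (hP : DifferentiableOn ℂ P unitDisk) (hP0 : P 0 = 0)
    (hle : ∀ w ∈ unitDisk, ‖p w‖ ≤ (P (‖w‖ : ℝ)).re) (hz : z ∈ unitDisk) :
    ‖integralFromZero (fun t => p t / t) z‖ ≤
      (integralFromZero (fun t => P t / t) (‖z‖ : ℝ)).re := by
  have hrd := ofReal_norm_mem_unitDisk hz
  have hc := continuousOn_dslope_mul hP hrd
  rw [integralFromZero_div_eq hp0, integralFromZero_div_eq hP0, ← reCLM_apply,
    ← reCLM.intervalIntegral_comp_comm hc.intervalIntegrable]
  refine intervalIntegral.norm_integral_le_of_norm_le zero_le_one (Filter.Eventually.of_forall ?_)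
    (reCLM.continuous.comp_continuousOn hc).intervalIntegrable
  intro s hs
  have h1 := hle _ (ofReal_mul_mem_unitDisk hz ⟨hs.1.le, hs.2⟩)
  have h2 : ‖(s : ℂ) * z‖ = s * ‖z‖ := by
    rw [norm_mul, norm_real, Real.norm_of_nonneg hs.1.le]
  rw [h2] at h1
  rw [← div_mul_eq_dslope hp0 hs.1.ne', ← div_mul_eq_dslope hP0 hs.1.ne', norm_mul, norm_div, h2,
    reCLM_apply, re_mul_ofReal, ← ofReal_mul, div_ofReal_re]
  gcongr
  exact mul_nonneg hs.1.le (norm_nonneg z)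

end IntegralFromZero

/-! ### The function `ψ` and its extremal function on the real axis. -/

section MaMinda

variable {ψ : ℂ → ℂ}

theorem IsMaMindaFunction.ofReal_im (hψ : IsMaMindaFunction ψ) {r : ℝ}
    (hr : r ∈ Ico (0 : ℝ) 1) : (ψ r).im = 0 := by
  have hrd : (r : ℂ) ∈ unitDisk := by
    rw [mem_unitDisk_iff, norm_real, Real.norm_of_nonneg hr.1]; exact hr.2
  have h1 := imCLM.hasSum (hasSum_taylorSeries_on_ball hψ.differentiableOn hrd)
  refine h1.unique ?_
  convert! hasSum_zero using 2 with n
  have := (hψ.coeff_nonneg n).2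
  simp only [sub_zero, smul_eq_mul, imCLM_apply]
  rw [← ofReal_pow, ← ofReal_natCast, ← ofReal_inv, im_ofReal_mul, im_ofReal_mul, this]
  simp

/-- Termwise comparison of Taylor series, whose coefficients equal their own moduli. -/
theorem IsMaMindaFunction.norm_sub_one_le (hψ : IsMaMindaFunction ψ) {z : ℂ} {r : ℝ}
    (hz : ‖z‖ ≤ r) (hr : r < 1) : ‖ψ z - 1‖ ≤ (ψ r - 1).re := by
  have hr0 : 0 ≤ r := (norm_nonneg z).trans hz
  have hrd : (r : ℂ) ∈ unitDisk := by
    rw [mem_unitDisk_iff, norm_real, Real.norm_of_nonneg hr0]; exact hr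
  have hzd : z ∈ unitDisk := mem_unitDisk_iff.2 (hz.trans_lt hr)
  have h1 := (hasSum_nat_add_iff' 1).2 (hasSum_taylorSeries_on_ball hψ.differentiableOn hzd)
  have h2 := (hasSum_nat_add_iff' 1).2 (hasSum_taylorSeries_on_ball hψ.differentiableOn hrd)
  have e : ∀ w : ℂ, ∑ n ∈ Finset.range 1,
      ((n.factorial : ℕ) : ℂ)⁻¹ • (w - 0) ^ n • iteratedDeriv n ψ 0 = 1 := by
    intro w; simp [hψ.map_zero]
  rw [e] at h1 h2
  refine h1.norm_le_of_bounded (reCLM.hasSum h2) fun n => ?_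
  obtain ⟨h3, h4⟩ := hψ.coeff_nonneg (n + 1)
  have h5 : ‖iteratedDeriv (n + 1) ψ 0‖ = (iteratedDeriv (n + 1) ψ 0).re := by
    rw [← abs_of_nonneg h3]; exact (abs_re_eq_norm.2 h4).symm
  simp only [sub_zero, smul_eq_mul, reCLM_apply]
  rw [← ofReal_pow, ← ofReal_natCast, ← ofReal_inv, re_ofReal_mul, re_ofReal_mul, norm_mul,
    norm_mul, norm_pow, h5, norm_real, Real.norm_of_nonneg (by positivity)]
  gcongr

/-- The exponent in the definition of `h_ψ`. -/
noncomputable def maMindaExponent (ψ : ℂ → ℂ) : ℂ → ℂ :=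
  integralFromZero fun t => (ψ t - 1) / t

theorem hasDerivAt_mul_exp_integral {p : ℂ → ℂ} (hp : DifferentiableOn ℂ p unitDisk)
    (hp0 : p 0 = 1) {z : ℂ} (hz : z ∈ unitDisk) :
    HasDerivAt (fun w => w * exp (integralFromZero (fun t => (p t - 1) / t) w))
      (p z * exp (integralFromZero (fun t => (p t - 1) / t) z)) z := by
  have h0 : (fun t => p t - 1) 0 = 0 := by simp [hp0]
  have h1 := hasDerivAt_integralFromZero_div (hp.sub_const 1) h0 hz
  convert! (hasDerivAt_id z).mul h1.cexp using 1
  have h2 := mul_dslope_zero (p := fun t => p t - 1) h0 z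
  simp only [id]
  linear_combination -(exp (integralFromZero (fun t => (p t - 1) / t) z)) * h2

/-- The value of `h_ψ'(r)` for real `r`. -/
noncomputable def maMindaDeriv (ψ : ℂ → ℂ) (r : ℝ) : ℝ :=
  (ψ r).re * Real.exp (maMindaExponent ψ r).re

/-- The value of `h_ψ(r) / r` for real `r`. -/
noncomputable def maMindaRatio (ψ : ℂ → ℂ) (r : ℝ) : ℝ :=
  Real.exp (maMindaExponent ψ r).re

theorem IsMaMindaFunction.exp_maMindaExponent (hψ : IsMaMindaFunction ψ) {r : ℝ}
    (hr : r ∈ Ico (0 : ℝ) 1) : exp (maMindaExponent ψ r) = maMindaRatio ψ r := by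
  have him : (maMindaExponent ψ r).im = 0 :=
    integralFromZero_div_ofReal_im (hψ.differentiableOn.sub_const 1) (by simp [hψ.map_zero]) hr
      fun t ht => by simp [hψ.ofReal_im ht]
  rw [maMindaRatio, ofReal_exp]
  congr 1
  exact Complex.ext (by simp) (by simp [him])

theorem IsMaMindaFunction.deriv_maMindaExtremal (hψ : IsMaMindaFunction ψ) {r : ℝ}
    (hr : r ∈ Ico (0 : ℝ) 1) : deriv (maMindaExtremal ψ) r = maMindaDeriv ψ r := by
  have hrd : (r : ℂ) ∈ unitDisk := by
    rw [mem_unitDisk_iff, norm_real, Real.norm_of_nonneg hr.1]; exact hr.2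
  have h1 := (hasDerivAt_mul_exp_integral hψ.differentiableOn hψ.map_zero hrd).deriv
  have h2 := hψ.exp_maMindaExponent hr
  rw [maMindaExponent] at h2
  rw [h2] at h1
  refine h1.trans ?_
  rw [maMindaDeriv, ofReal_mul, ← maMindaRatio]
  congr 1
  exact Complex.ext (by simp) (by simp [hψ.ofReal_im hr])

theorem IsMaMindaFunction.derivRoots_eq (hψ : IsMaMindaFunction ψ) :
    derivRoots ψ = {r | r ∈ Ioo (0 : ℝ) 1 ∧ maMindaDeriv ψ r = 5 / 4} := by
  ext r
  refine and_congr_right fun hr => ?_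
  rw [hψ.deriv_maMindaExtremal ⟨hr.1.le, hr.2⟩, sub_eq_zero]
  norm_cast
  rw [← ofReal_inj]
  norm_num

theorem IsMaMindaFunction.valueRoots_eq (hψ : IsMaMindaFunction ψ) :
    valueRoots ψ = {r | r ∈ Ioo (0 : ℝ) 1 ∧ maMindaRatio ψ r = 5 / 4} := by
  ext r
  refine and_congr_right fun hr => ?_
  have h1 : maMindaExtremal ψ r = r * maMindaRatio ψ r := by
    rw [← hψ.exp_maMindaExponent ⟨hr.1.le, hr.2⟩]; rfl
  rw [h1]
  have h2 : 4 * ((r : ℂ) * maMindaRatio ψ r) - 5 * r =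
      ((4 * r * (maMindaRatio ψ r - 5 / 4) : ℝ) : ℂ) := by
    push_cast; ring
  rw [h2, ofReal_eq_zero, mul_eq_zero, sub_eq_zero]
  simp [hr.1.ne']

theorem IsMaMindaFunction.continuousOn_maMindaRatio (hψ : IsMaMindaFunction ψ) :
    ContinuousOn (maMindaRatio ψ) (Ico 0 1) := by
  have h0 := (differentiableOn_integralFromZero_div (hψ.differentiableOn.sub_const 1)
    (by simp [hψ.map_zero])).continuousOn
  refine Real.continuous_exp.comp_continuousOn (continuous_re.comp_continuousOn
    (h0.comp continuous_ofReal.continuousOn fun r hr => ?_))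
  rw [mem_unitDisk_iff, norm_real, Real.norm_of_nonneg hr.1]; exact hr.2

theorem IsMaMindaFunction.continuousOn_maMindaDeriv (hψ : IsMaMindaFunction ψ) :
    ContinuousOn (maMindaDeriv ψ) (Ico 0 1) := by
  refine ContinuousOn.mul (continuous_re.comp_continuousOn
    (hψ.differentiableOn.continuousOn.comp continuous_ofReal.continuousOn fun r hr => ?_))
    hψ.continuousOn_maMindaRatio
  rw [mem_unitDisk_iff, norm_real, Real.norm_of_nonneg hr.1]; exact hr.2

theorem maMindaRatio_zero : maMindaRatio ψ 0 = 1 := by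
  simp [maMindaRatio, maMindaExponent, integralFromZero_zero]

theorem IsMaMindaFunction.maMindaDeriv_zero (hψ : IsMaMindaFunction ψ) :
    maMindaDeriv ψ 0 = 1 := by
  simp [maMindaDeriv, maMindaExponent, integralFromZero_zero, hψ.map_zero]

end MaMinda

/-! ### Representation and distortion in the Ma-Minda class. -/

section Starlike

variable {ψ h p : ℂ → ℂ}

/-- The solution of `z h' = p h`, `h(0) = 0`, `h'(0) = 1`, `p(0) = 1`. -/
theorem eq_mul_exp_integral (hp : DifferentiableOn ℂ p unitDisk) (hp0 : p 0 = 1)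
    (hh : DifferentiableOn ℂ h unitDisk) (h0 : h 0 = 0) (h1 : deriv h 0 = 1)
    (heq : ∀ z ∈ unitDisk, z * deriv h z = p z * h z) {z : ℂ} (hz : z ∈ unitDisk) :
    h z = z * exp (integralFromZero (fun t => (p t - 1) / t) z) := by
  have hpz : (fun t => p t - 1) 0 = 0 := by simp [hp0]
  set q := integralFromZero (fun t => (p t - 1) / t) with hq
  have hqd : ∀ w ∈ unitDisk, HasDerivAt q (dslope (fun t => p t - 1) 0 w) w := fun w hw =>
    hasDerivAt_integralFromZero_div (hp.sub_const 1) hpz hw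
  -- The integrating factor turns the equation into `z u' = u`, so `u / z` has zero derivative away
  -- from the origin; continuity of that derivative covers the origin.
  set u : ℂ → ℂ := fun w => h w * exp (-q w) with hu
  have hud : ∀ w ∈ unitDisk, HasDerivAt u
      (deriv h w * exp (-q w) + h w * (exp (-q w) * -dslope (fun t => p t - 1) 0 w)) w :=
    fun w hw => (hh.differentiableAt (unitDisk_mem_nhds hw)).hasDerivAt.mul (hqd w hw).neg.cexp
  have hu0 : u 0 = 0 := by simp [hu, h0]
  have huD : DifferentiableOn ℂ u unitDisk := fun w hw =>
    (hud w hw).differentiableAt.differentiableWithinAt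
  have hzu : ∀ w ∈ unitDisk, w * deriv u w = u w := by
    intro w hw
    rw [(hud w hw).deriv]
    have h2 := mul_dslope_zero (p := fun t => p t - 1) hpz w
    have h3 := heq w hw
    simp only [hu]
    linear_combination exp (-q w) * h3 - h w * exp (-q w) * h2
  have hvD : DifferentiableOn ℂ (dslope u 0) unitDisk := differentiableOn_dslope_zero huD
  have hv' : ∀ w ∈ unitDisk, w ≠ 0 → deriv (dslope u 0) w = 0 := by
    intro w hw hw0
    have h2 : deriv (fun y => y * dslope u 0 y) w = deriv u w := by
      congr 1; ext y; exact mul_dslope_zero hu0 y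
    have h3 := ((hasDerivAt_id w).mul
      (hvD.differentiableAt (unitDisk_mem_nhds hw)).hasDerivAt).deriv
    have h4 := hzu w hw
    have h5 := mul_dslope_zero hu0 w
    have h6 : deriv u w = dslope u 0 w + w * deriv (dslope u 0) w := by
      rw [← h2]; simpa using! h3
    have h7 : w * (w * deriv (dslope u 0) w) = 0 := by
      linear_combination h4 - h5 - w * h6
    simpa [hw0] using h7
  have hv'0 : deriv (dslope u 0) 0 = 0 := by
    have hc : ContinuousAt (deriv (dslope u 0)) 0 :=
      ((hvD.deriv isOpen_ball).continuousOn.continuousAt (unitDisk_mem_nhds zero_mem_unitDisk))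
    refine tendsto_nhds_unique (l := nhdsWithin 0 {0}ᶜ)
      (hc.tendsto.mono_left nhdsWithin_le_nhds) (tendsto_const_nhds.congr' ?_)
    filter_upwards [self_mem_nhdsWithin,
      nhdsWithin_le_nhds (unitDisk_mem_nhds zero_mem_unitDisk)] with w hw hw'
    exact (hv' w hw' hw).symm
  have hconst := isOpen_ball.is_const_of_deriv_eq_zero (convex_ball (0 : ℂ) 1).isPreconnected hvD
    (fun w hw => by
      rcases eq_or_ne w 0 with rfl | hw0
      · exact hv'0
      · exact hv' w hw hw0) hz zero_mem_unitDisk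
  have hv0 : dslope u 0 0 = 1 := by
    rw [dslope_same, (hud 0 zero_mem_unitDisk).deriv, h0, h1]
    simp [hq, integralFromZero_zero]
  have h8 := mul_dslope_zero hu0 z
  rw [hconst, hv0, mul_one] at h8
  have h9 : z * exp (q z) = h z * exp (-q z) * exp (q z) := congrArg (· * exp (q z)) h8
  rw [h9, mul_assoc, ← exp_add, neg_add_cancel, exp_zero, mul_one]

/-- The series of `exp w - 1` has nonnegative coefficients. -/
theorem norm_exp_sub_one_le_of_norm_le {w : ℂ} {M : ℝ} (hw : ‖w‖ ≤ M) :
    ‖exp w - 1‖ ≤ Real.exp M - 1 := by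
  have h1 := norm_exp_sub_sum_le_exp_norm_sub_sum w 1
  simp only [Finset.range_one, Finset.sum_singleton, pow_zero, Nat.factorial_zero, Nat.cast_one,
    div_one] at h1
  exact h1.trans (sub_le_sub_right (Real.exp_le_exp.2 hw) 1)

/-- Growth and distortion in `S*(ψ)`: `h(z) = z k(z)` with `k` and `h'` close to `1`. -/
theorem IsMaMindaStarlike.norm_dslope_sub_one_and_norm_deriv_sub_one_le (hψ : IsMaMindaFunction ψ)
    (hh : IsMaMindaStarlike ψ h) {z : ℂ} (hz : z ∈ unitDisk) :
    ‖dslope h 0 z - 1‖ ≤ maMindaRatio ψ ‖z‖ - 1 ∧ ‖deriv h z - 1‖ ≤ maMindaDeriv ψ ‖z‖ - 1 := by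
  obtain ⟨ω, hωd, hωm, hω0, hω⟩ := hh.subordinate
  set p : ℂ → ℂ := fun w => ψ (ω w) with hpdef
  have hp : DifferentiableOn ℂ p unitDisk := hψ.differentiableOn.comp hωd hωm
  have hp0 : p 0 = 1 := by simp [hpdef, hω0, hψ.map_zero]
  have heq : ∀ w ∈ unitDisk, w * deriv h w = p w * h w := by
    intro w hw
    rcases eq_or_ne w 0 with rfl | hw0
    · simp [hh.map_zero]
    · have h1 := hω w hw
      rw [starlikeQuotient, if_neg hw0] at h1
      have h2 : h w ≠ 0 := by
        intro h3
        have h4 := hψ.re_pos _ (hωm hw)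
        rw [← h1, h3] at h4
        simp at h4
      have h3 : p w = w * deriv h w / h w := h1.symm
      rw [h3]
      field_simp
  have hform : ∀ w ∈ unitDisk, _ := fun w hw =>
    eq_mul_exp_integral hp hp0 hh.differentiableOn hh.map_zero hh.deriv_zero heq (z := w) hw
  have hderiv : deriv h z = p z * exp (integralFromZero (fun t => (p t - 1) / t) z) := by
    refine HasDerivAt.deriv ((hasDerivAt_mul_exp_integral hp hp0 hz).congr_of_eventuallyEq ?_)
    filter_upwards [unitDisk_mem_nhds hz] with w hw using hform w hw
  have hdslope : dslope h 0 z = exp (integralFromZero (fun t => (p t - 1) / t) z) := by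
    rcases eq_or_ne z 0 with rfl | hz0
    · rw [dslope_same, hh.deriv_zero, integralFromZero_zero, exp_zero]
    · exact mul_left_cancel₀ hz0 ((mul_dslope_zero hh.map_zero z).trans (hform z hz))
  have hple : ∀ w ∈ unitDisk, ‖p w - 1‖ ≤ (ψ (‖w‖ : ℝ) - 1).re := by
    intro w hw
    have hw1 := mem_unitDisk_iff.1 hw
    exact hψ.norm_sub_one_le (norm_le_norm_of_mapsTo_ball hωd
      (hωm.mono_right ball_subset_closedBall) hω0 hw1) hw1
  have hI : ‖integralFromZero (fun t => (p t - 1) / t) z‖ ≤ (maMindaExponent ψ (‖z‖ : ℝ)).re :=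
    norm_integralFromZero_div_le (p := fun t => p t - 1) (P := fun t => ψ t - 1) (by simp [hp0])
      (hψ.differentiableOn.sub_const 1) (by simp [hψ.map_zero]) hple hz
  have hE := norm_exp_sub_one_le_of_norm_le hI
  refine ⟨hdslope ▸ hE, ?_⟩
  rw [hderiv]
  set k := exp (integralFromZero (fun t => (p t - 1) / t) z)
  -- Written in `p - 1` and `k - 1`, the expression has nonnegative coefficients, so the separate
  -- majorants can be substituted.
  have e : p z * k - 1 = (p z - 1) * (k - 1) + ((p z - 1) + (k - 1)) := by ring
  have h3 := hple z hz
  rw [sub_re, one_re] at h3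
  calc ‖p z * k - 1‖ ≤ ‖p z - 1‖ * ‖k - 1‖ + (‖p z - 1‖ + ‖k - 1‖) := by
        rw [e, ← norm_mul]
        exact (norm_add_le _ _).trans (by gcongr; exact norm_add_le _ _)
    _ ≤ ((ψ (‖z‖ : ℝ)).re - 1) * (maMindaRatio ψ ‖z‖ - 1) +
        (((ψ (‖z‖ : ℝ)).re - 1) + (maMindaRatio ψ ‖z‖ - 1)) := by
        have h4 : 0 ≤ (ψ (‖z‖ : ℝ)).re - 1 := (norm_nonneg _).trans h3
        have h5 : ‖k - 1‖ ≤ maMindaRatio ψ ‖z‖ - 1 := hE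
        gcongr
    _ = maMindaDeriv ψ ‖z‖ - 1 := by rw [maMindaDeriv, ← maMindaRatio]; ring

end Starlike

/-- A continuous function on `[0, 1)` that starts below `c` stays below `c` before the smallest
solution of `u = c`, which exists as soon as there is a solution. -/
theorem exists_isLeast_and_lt {u : ℝ → ℝ} {c : ℝ} (hu : ContinuousOn u (Ico 0 1))
    (h0 : u 0 < c) :
    (({r | r ∈ Ioo (0 : ℝ) 1 ∧ u r = c}.Nonempty → ∃ r₀,
        IsLeast {r | r ∈ Ioo (0 : ℝ) 1 ∧ u r = c} r₀ ∧ ∀ r ∈ Ico 0 r₀, u r < c) ∧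
      ({r | r ∈ Ioo (0 : ℝ) 1 ∧ u r = c} = ∅ → ∀ r ∈ Ico (0 : ℝ) 1, u r < c)) := by
  have hivt : ∀ r ∈ Ico (0 : ℝ) 1, c ≤ u r → ∃ s ∈ Ioc 0 r, u s = c := by
    intro r hr hc
    have hsub : Icc 0 r ⊆ Ico (0 : ℝ) 1 := fun x hx => ⟨hx.1, hx.2.trans_lt hr.2⟩
    obtain ⟨s, hs, hus⟩ := intermediate_value_Icc hr.1 (hu.mono hsub) ⟨h0.le, hc⟩
    refine ⟨s, ⟨hs.1.lt_of_ne ?_, hs.2⟩, hus⟩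
    rintro rfl
    exact h0.ne hus
  refine ⟨?_, ?_⟩
  · rintro ⟨r₁, hr₁, hur₁⟩
    have hsub : Icc 0 r₁ ⊆ Ico (0 : ℝ) 1 := fun x hx => ⟨hx.1, hx.2.trans_lt hr₁.2⟩
    -- Cutting at a known root `r₁` keeps the root set away from `1`, where `u` is not controlled;
    -- `u 0 < c` keeps it away from `0`.
    have hcomp : IsCompact (Icc 0 r₁ ∩ u ⁻¹' {c}) :=
      isCompact_Icc.of_isClosed_subset
        ((hu.mono hsub).preimage_isClosed_of_isClosed isClosed_Icc isClosed_singleton)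
        inter_subset_left
    obtain ⟨r₀, ⟨hr₀, hur₀⟩, hmin⟩ := hcomp.exists_isLeast ⟨r₁, ⟨hr₁.1.le, le_rfl⟩, hur₁⟩
    have hr₀pos : 0 < r₀ := by
      refine hr₀.1.lt_of_ne ?_
      rintro rfl
      exact h0.ne hur₀
    refine ⟨r₀, ⟨⟨⟨hr₀pos, hr₀.2.trans_lt hr₁.2⟩, hur₀⟩, ?_⟩, ?_⟩
    · rintro r ⟨hr, hur⟩
      rcases le_total r r₁ with h | h
      · exact hmin ⟨⟨hr.1.le, h⟩, hur⟩
      · exact hr₀.2.trans h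
    · intro r hr
      by_contra! hc
      obtain ⟨s, hs, hus⟩ := hivt r ⟨hr.1, hr.2.trans (hr₀.2.trans_lt hr₁.2)⟩ hc
      have := hmin ⟨⟨hs.1.le, hs.2.trans (hr.2.le.trans hr₀.2)⟩, hus⟩
      linarith [hs.2, hr.2]
  · intro hempty r hr
    by_contra! hc
    obtain ⟨s, hs, hus⟩ := hivt r hr hc
    exact (Set.ext_iff.1 hempty s).1 ⟨⟨hs.1, hs.2.trans_lt hr.2⟩, hus⟩

/-! ### Bounds on the co-analytic part and the two radii. -/

section Radius

variable {ψ h g φ : ℂ → ℂ} {R : ℝ}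

/-- Schwarz lemma for the dilatation `g'/h'`, which is bounded by `1` and vanishes at `0`. -/
theorem IsClassSH0.norm_deriv_right_le (hf : IsClassSH0 h g) {z : ℂ} (hz : z ∈ unitDisk) :
    ‖deriv g z‖ ≤ ‖z‖ * ‖deriv h z‖ := by
  have hlt : ∀ w ∈ unitDisk, ‖deriv g w‖ < ‖deriv h w‖ := fun w hw =>
    lt_of_pow_lt_pow_left₀ 2 (norm_nonneg _) (sub_pos.1 (hf.jacobian_pos w hw))
  have hne : ∀ w ∈ unitDisk, deriv h w ≠ 0 := fun w hw =>
    norm_pos_iff.1 ((norm_nonneg _).trans_lt (hlt w hw))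
  have hd : DifferentiableOn ℂ (fun w => deriv g w / deriv h w) unitDisk :=
    (hf.differentiableOn_right.deriv isOpen_ball).div
      (hf.differentiableOn_left.deriv isOpen_ball) hne
  have hm : MapsTo (fun w => deriv g w / deriv h w) (ball 0 1) (closedBall 0 1) := by
    intro w hw
    rw [mem_closedBall_zero_iff, norm_div]
    exact div_le_one_of_le₀ (hlt w hw).le (norm_nonneg _)
  have h1 := norm_le_norm_of_mapsTo_ball hd hm (by simp [hf.deriv_right_zero])
    (mem_unitDisk_iff.1 hz)
  rw [norm_div] at h1
  exact (div_le_iff₀ (norm_pos_iff.2 (hne z hz))).1 h1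

theorem norm_dslope_mul_le (hφ : IsBoundedByOne φ) (hg : ∀ z ∈ unitDisk, g z = φ z * h z)
    (hf : IsClassSH0 h g) {z : ℂ} (hz : z ∈ unitDisk) :
    ‖dslope g 0 z‖ ≤ ‖z‖ * ‖dslope h 0 z‖ := by
  -- Differentiating `g = φ h` at `0` gives `g'(0) = φ(0)`, so the Schwarz lemma applies to `φ`.
  have hφ0 : φ 0 = 0 := by
    have h1 := ((hφ.differentiableOn.differentiableAt
      (unitDisk_mem_nhds zero_mem_unitDisk)).hasDerivAt.mul
      (hf.differentiableOn_left.differentiableAt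
        (unitDisk_mem_nhds zero_mem_unitDisk)).hasDerivAt).congr_of_eventuallyEq (f₁ := g)
      (Filter.eventually_of_mem (unitDisk_mem_nhds zero_mem_unitDisk) hg)
    have h2 := h1.deriv
    rw [hf.deriv_right_zero, hf.left_zero, hf.deriv_left_zero] at h2
    simpa using h2.symm
  rcases eq_or_ne z 0 with rfl | hz0
  · simp [hf.deriv_right_zero]
  · have h1 : dslope g 0 z = φ z * dslope h 0 z := by
      refine mul_left_cancel₀ hz0 ?_
      rw [mul_dslope_zero hf.right_zero, hg z hz, ← mul_dslope_zero hf.left_zero z]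
      ring
    rw [h1, norm_mul]
    gcongr
    exact norm_le_norm_of_mapsTo_ball hφ.differentiableOn
      (fun w hw => mem_closedBall_zero_iff.2 (hφ.norm_le_one w hw)) hφ0 (mem_unitDisk_iff.1 hz)

theorem le_five_twelfths {a : ℂ} {r s : ℝ} (hr : r ≤ 1 / 3) (ha : ‖a - 1‖ ≤ 1 / 4)
    (hs : s ≤ r * ‖a‖) : s ≤ 5 / 12 := by
  have h1 := norm_add_le (a - 1) 1
  rw [sub_add_cancel, norm_one] at h1
  nlinarith [norm_nonneg a]

theorem isUniformlyStarlike_of_maMindaDeriv_lt (hψ : IsMaMindaFunction ψ)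
    (hh : IsMaMindaStarlike ψ h) (hf : IsClassSH0 h g) (hR : R ≤ 1 / 3)
    (hlt : ∀ r ∈ Ico 0 R, maMindaDeriv ψ r < 5 / 4) :
    IsUniformlyStarlike (harmonicMap h g) R := by
  have hsub : ball (0 : ℂ) R ⊆ unitDisk := ball_subset_ball (by linarith)
  have hb : ∀ z ∈ ball (0 : ℂ) R, ‖deriv h z - 1‖ ≤ 1 / 4 := fun z hz => by
    have h1 := (hh.norm_dslope_sub_one_and_norm_deriv_sub_one_le hψ (hsub hz)).2
    have h2 := hlt ‖z‖ ⟨norm_nonneg z, mem_ball_zero_iff.1 hz⟩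
    linarith
  refine isUniformlyStarlike_harmonicMap (hf.differentiableOn_left.mono hsub)
    (hf.differentiableOn_right.mono hsub) hf.left_zero hf.right_zero hb fun z hz => ?_
  exact le_five_twelfths ((mem_ball_zero_iff.1 hz).le.trans hR) (hb z hz)
    (hf.norm_deriv_right_le (hsub hz))

theorem isUniformlyStarlike_of_maMindaRatio_lt (hψ : IsMaMindaFunction ψ)
    (hh : IsMaMindaStarlike ψ h) (hφ : IsBoundedByOne φ)
    (hg : ∀ z ∈ unitDisk, g z = φ z * h z) (hf : IsClassSH0 h g) (hR : R ≤ 1 / 3)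
    (hlt : ∀ r ∈ Ico 0 R, maMindaRatio ψ r < 5 / 4) :
    IsUniformlyStarlike (lambdaOperator h g) R := by
  have hsub : ball (0 : ℂ) R ⊆ unitDisk := ball_subset_ball (by linarith)
  have hb : ∀ z ∈ ball (0 : ℂ) R, ‖dslope h 0 z - 1‖ ≤ 1 / 4 := fun z hz => by
    have h1 := (hh.norm_dslope_sub_one_and_norm_deriv_sub_one_le hψ (hsub hz)).1
    have h2 := hlt ‖z‖ ⟨norm_nonneg z, mem_ball_zero_iff.1 hz⟩
    linarith
  refine isUniformlyStarlike_harmonicMap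
    ((differentiableOn_integralFromZero_div hf.differentiableOn_left hf.left_zero).mono hsub)
    ((differentiableOn_integralFromZero_div hf.differentiableOn_right hf.right_zero).mono hsub)
    (integralFromZero_zero _) (integralFromZero_zero _) (fun z hz => ?_) fun z hz => ?_
  · rw [(hasDerivAt_integralFromZero_div hf.differentiableOn_left hf.left_zero (hsub hz)).deriv]
    exact hb z hz
  · rw [(hasDerivAt_integralFromZero_div hf.differentiableOn_right hf.right_zero (hsub hz)).deriv]
    exact le_five_twelfths ((mem_ball_zero_iff.1 hz).le.trans hR) (hb z hz)
      (norm_dslope_mul_le hφ hg hf (hsub hz))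

end Radius

theorem mainTheorem10 (ψ h g φ : ℂ → ℂ)
    (hψ : IsMaMindaFunction ψ)
    (hh : IsMaMindaStarlike ψ h)
    (hφ : IsBoundedByOne φ)
    (hg : ∀ z ∈ unitDisk, g z = φ z * h z)
    (hf : IsClassSH0 h g) :
    (((derivRoots ψ).Nonempty → ∃ rψ : ℝ, IsLeast (derivRoots ψ) rψ ∧
        IsUniformlyStarlike (harmonicMap h g) (min (1 / 3) rψ)) ∧
      (derivRoots ψ = ∅ → IsUniformlyStarlike (harmonicMap h g) (1 / 3))) ∧
    (((valueRoots ψ).Nonempty → ∃ rψ : ℝ, IsLeast (valueRoots ψ) rψ ∧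
        IsUniformlyStarlike (lambdaOperator h g) (min (1 / 3) rψ)) ∧
      (valueRoots ψ = ∅ → IsUniformlyStarlike (lambdaOperator h g) (1 / 3))) := by
  rw [hψ.derivRoots_eq, hψ.valueRoots_eq]
  obtain ⟨hd1, hd2⟩ := exists_isLeast_and_lt (c := 5 / 4) hψ.continuousOn_maMindaDeriv
    (by rw [hψ.maMindaDeriv_zero]; norm_num)
  obtain ⟨hv1, hv2⟩ := exists_isLeast_and_lt (c := 5 / 4) hψ.continuousOn_maMindaRatio
    (by rw [maMindaRatio_zero]; norm_num)
  refine ⟨⟨fun hne => ?_, fun he => ?_⟩, fun hne => ?_, fun he => ?_⟩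
  · obtain ⟨r₀, hr₀, hlt⟩ := hd1 hne
    exact ⟨r₀, hr₀, isUniformlyStarlike_of_maMindaDeriv_lt hψ hh hf (min_le_left _ _)
      fun r hr => hlt r ⟨hr.1, hr.2.trans_le (min_le_right _ _)⟩⟩
  · exact isUniformlyStarlike_of_maMindaDeriv_lt hψ hh hf le_rfl
      fun r hr => hd2 he r ⟨hr.1, hr.2.trans (by norm_num)⟩
  · obtain ⟨r₀, hr₀, hlt⟩ := hv1 hne
    exact ⟨r₀, hr₀, isUniformlyStarlike_of_maMindaRatio_lt hψ hh hφ hg hf (min_le_left _ _)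
      fun r hr => hlt r ⟨hr.1, hr.2.trans_le (min_le_right _ _)⟩⟩
  · exact isUniformlyStarlike_of_maMindaRatio_lt hψ hh hφ hg hf le_rfl
      fun r hr => hv2 he r ⟨hr.1, hr.2.trans (by norm_num)⟩
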